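/- Let $s(n,k)$ denote the (signed) Stirling numbers of the first kind, given by $\frac{[\ln(1+x)]^k}{k!}=\sum_{n\ge k}s(n,k)\frac{x^n}{n!}$, and for integers $k\ge1$, $m\ge2$ put $$Q(k,m)=\sum_{\ell=0}^{m}\binom{k+\ell-1}{k-1}\,s(k+m-1,k+\ell-1)\Bigl(\frac{k+m-2}{2}\Bigr)^{\ell}.$$ For integers $m\ge k\ge1$ let $$B_{m,k}(x_1,\dots,x_{m-k+1})=\sum\frac{m!}{\prod_{i=1}^{m-k+1}\ell_i!}\prod_{i=1}^{m-k+1}\Bigl(\frac{x_i}{i!}\Bigr)^{\ell_i}$$ be the partial Bell polynomial, where the sum runs over all tuples of integers $\ell_1,\dots,\ell_{m-k+1}\ge0$ with $\sum_i i\,\ell_i=m$ and $\sum_i\ell_i=k$. Let $f(x)=\frac{(\arccos x)^2}{2(1-x)}$. Then $f$ is infinitely differentiable on $(-1,1)$ and, for every $n\ge1$, the limit $f^{(n)}(1^-):=\lim_{x\to1^-}f^{(n)}(x)$ exists in $\mathbb{R}$. For all integers $m\ge k\ge1$, $$B_{m,k}\bigl(f'(1^-),f''(1^-),\dots,f^{(m-k+1)}(1^-)\bigr)=2^k\,B_{m,k}(b_1,b_2,\dots,b_{m-k+1}),\qquad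 b_n=\frac{(2n)!!}{(2n+2)!}\,Q(2,2n),$$ where $b_1=-\frac1{12}$, $b_2=\frac2{45}$, $b_3=-\frac3{70}$, $b_4=\frac{32}{525}$, $b_5=-\frac{80}{693}$, and $$B_{m,k}\bigl(f'(1^-),\dots,f^{(m-k+1)}(1^-)\bigr)=(-2)^k\,[2(m-k)]!!\,\binom mk\sum_{j=1}^{k}(-1)^j(2j)!\binom kj\frac{Q(2j,2m)}{(2j+2m)!}.$$ -/

import Mathlib

open scoped Nat Topology ContDiff

/-- The (signed) Stirling numbers of the first kind `s(n, k)`, obtained from the unsigned ones of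
Mathlib by the sign `(-1) ^ (n - k)`; equivalently
`log (1 + x) ^ k / k! = ∑ n ≥ k, s(n, k) * x ^ n / n!`. -/
def signedStirlingFirst (n k : ℕ) : ℤ :=
  (-1) ^ (n + k) * (Nat.stirlingFirst n k : ℤ)

/-- `Q(k, m) = ∑_{ℓ = 0}^{m} C(k+ℓ-1, k-1) s(k+m-1, k+ℓ-1) ((k+m-2)/2)^ℓ` for `k ≥ 1`, `m ≥ 2`. -/
noncomputable def stirlingQ (k m : ℕ) : ℝ :=
  ∑ l ∈ Finset.range (m + 1),
    ((k + l - 1).choose (k - 1) : ℝ) * (signedStirlingFirst (k + m - 1) (k + l - 1) : ℝ) *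
      (((k : ℝ) + (m : ℝ) - 2) / 2) ^ l

/-- The partial Bell polynomial `B_{n,k}(x 1, x 2, …, x (n - k + 1))`. The summation variable `l`
runs over the families `(l 0, …, l (n - k))` of natural numbers with `∑ i, l i = k` and
`∑ i, (i + 1) * l i = n`; the entry `l i` is the exponent of `x (i + 1)`. -/
noncomputable def partialBell (n k : ℕ) (x : ℕ → ℝ) : ℝ :=
  ∑ l ∈ (Finset.piAntidiag (Finset.univ : Finset (Fin (n - k + 1))) k).filter
      (fun l => ∑ i : Fin (n - k + 1), ((i : ℕ) + 1) * l i = n),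
    (n ! : ℝ) / (∏ i, ((l i)! : ℝ)) *
      ∏ i : Fin (n - k + 1), (x ((i : ℕ) + 1) / (((i : ℕ) + 1)! : ℝ)) ^ l i

/-- The function `(arccos x)² / (2 (1 - x))`. -/
noncomputable def arccosSqQuot (x : ℝ) : ℝ :=
  Real.arccos x ^ 2 / (2 * (1 - x))

/-- The value at `x = 1⁻` of the `n`-th derivative of `(arccos x)² / (2 (1 - x))`, that is, the
limit of the `n`-th derivative as `x` tends to `1` from the left. -/
noncomputable def arccosSqQuotDeriv (n : ℕ) : ℝ :=
  Filter.limUnder (𝓝[<] (1 : ℝ)) (iteratedDeriv n arccosSqQuot)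

/-- The sequence `(2n)!! / (2n+2)! * Q(2, 2n)`, which starts `-1/12, 2/45, -3/70, …` at `n = 1`. -/
noncomputable def bellArg (n : ℕ) : ℝ :=
  ((2 * n)‼ : ℝ) / ((2 * n + 2)! : ℝ) * stirlingQ 2 (2 * n)

/-! Substituting `x = cos y` turns `(1 - x²) ∂² - x ∂` into `d²/dy²`, so this operator sends `arccos
^ (2j+2) / (2j+2)!` to `arccos ^ (2j) / (2j)!`. On coefficients in `t = x - 1` this is the
recurrence of the numbers `[X^j] ∏_{i<n} (X - i²)`, and `Q(2j, 2m)` is such a number with `n = m +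
j` (`stirlingQ_even`). Dividing by `(-2t)^j` gives the coefficients of `f ^ j`
(`coeff_arccosSqQuot_pow`). Since `f(1⁻) = 1`, the Bell polynomial is `m!/k! · [t^m] (f - 1)^k`
(`partialBell_eq_coeff`), and the binomial theorem yields the sum over `j`. The formal series is
tied to the actual `f` by an ODE: its sum equals `f` on `(-1, 1)` and is analytic at `1`, so the
one-sided limits are Taylor coefficients times `n!`. -/

section StirlingPolynomials

/-! ### Stirling sums as central factorial numbers. -/

open Polynomial

theorem descPochhammer_coeff (n k : ℕ) :
    (descPochhammer ℝ n).coeff k = (signedStirlingFirst n k : ℝ) := by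
  induction n generalizing k with
  | zero =>
    cases k with
    | zero => simp [signedStirlingFirst]
    | succ k => simp [signedStirlingFirst, Polynomial.coeff_one]
  | succ n ih =>
    rw [descPochhammer_succ_right, mul_sub, coeff_sub, ← C_eq_natCast, coeff_mul_C, ih]
    cases k with
    | zero =>
      cases n with
      | zero => simp [signedStirlingFirst]
      | succ n => simp [signedStirlingFirst]
    | succ k =>
      rw [coeff_mul_X, ih]
      simp only [signedStirlingFirst, Nat.stirlingFirst_succ_succ]
      push_cast
      ring

theorem descPochhammer_taylor_coeff {n j : ℕ} (hj : j ≤ n) (r : ℝ) :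
    (taylor r (descPochhammer ℝ n)).coeff j =
      ∑ l ∈ Finset.range (n + 1 - j),
        ((j + l).choose j : ℝ) * (signedStirlingFirst n (j + l) : ℝ) * r ^ l := by
  rw [taylor_coeff, eval_eq_sum_range' (n := n + 1 - j)]
  · refine Finset.sum_congr rfl fun l _ => ?_
    rw [hasseDeriv_coeff, descPochhammer_coeff, add_comm l j]
  · have := natDegree_hasseDeriv_le (descPochhammer ℝ n) j
    rw [descPochhammer_natDegree] at this
    omega

/-- The polynomial `∏_{i < n} (X - i²)`, whose coefficients are the central factorial numbers. -/
noncomputable def centralFactorialPoly (n : ℕ) : ℝ[X] :=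
  ∏ i ∈ Finset.range n, (X - C ((i : ℝ) ^ 2))

theorem centralFactorialPoly_succ (n : ℕ) :
    centralFactorialPoly (n + 1) = centralFactorialPoly n * (X - C ((n : ℝ) ^ 2)) :=
  Finset.prod_range_succ _ _

/-- The roots `0, …, 2p`, recentred at their midpoint `p`, become `-p, …, p`. They pair up into
factors `X² - i²`, and the extra `X` completes the unpaired root `0` to `X²`. The induction step
adds one root at each end. -/
theorem taylor_descPochhammer_odd (p : ℕ) :
    X * taylor (p : ℝ) (descPochhammer ℝ (2 * p + 1)) =
      expand ℝ 2 (centralFactorialPoly (p + 1)) := by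
  induction p with
  | zero => simp [centralFactorialPoly]; ring
  | succ p ih =>
    rw [centralFactorialPoly_succ, map_mul, ← ih,
      show 2 * (p + 1) + 1 = 2 * p + 1 + 1 + 1 by ring, descPochhammer_succ_left,
      descPochhammer_succ_right]
    simp only [taylor_apply, mul_comp, comp_assoc, sub_comp, X_comp, one_comp, natCast_comp,
      map_sub, expand_X, expand_C]
    rw [show (X + C ((p + 1 : ℕ) : ℝ) - 1 : ℝ[X]) = X + C (p : ℝ) by
      simp only [Nat.cast_add, Nat.cast_one, C_add, C_1]; ring]
    simp only [C_pow, C_eq_natCast]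
    push_cast
    ring

/-- The coefficient `[X^k] ∏_{i < n} (X - i²)`. -/
noncomputable def centralFactorialCoeff (n k : ℕ) : ℝ := (centralFactorialPoly n).coeff k

theorem centralFactorialCoeff_zero (k : ℕ) :
    centralFactorialCoeff 0 k = if k = 0 then 1 else 0 := by
  simp [centralFactorialCoeff, centralFactorialPoly, coeff_one]

theorem centralFactorialCoeff_succ_zero (n : ℕ) : centralFactorialCoeff (n + 1) 0 = 0 := by
  simp [centralFactorialCoeff, centralFactorialPoly, Finset.prod_range_succ', mul_coeff_zero]

theorem centralFactorialCoeff_succ_succ (n k : ℕ) :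
    centralFactorialCoeff (n + 1) (k + 1) =
      centralFactorialCoeff n k - (n : ℝ) ^ 2 * centralFactorialCoeff n (k + 1) := by
  simp only [centralFactorialCoeff, centralFactorialPoly_succ, mul_sub, coeff_sub, coeff_mul_X,
    coeff_mul_C]
  ring

theorem centralFactorialCoeff_succ_one (n : ℕ) :
    centralFactorialCoeff (n + 1) 1 = (-1) ^ n * (n ! : ℝ) ^ 2 := by
  induction n with
  | zero => simp [centralFactorialCoeff_succ_succ, centralFactorialCoeff_zero]
  | succ n ih =>
    rw [centralFactorialCoeff_succ_succ, ih, centralFactorialCoeff_succ_zero, Nat.factorial_succ]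
    push_cast
    ring

/-- The point `(2j + 2m - 2)/2 = m + j - 1` is the midpoint of the roots of the falling factorial of
degree `2(m + j) - 1`, so the sum is its Taylor coefficient of order `2j - 1` there. -/
theorem stirlingQ_even {j : ℕ} (hj : 1 ≤ j) (m : ℕ) :
    stirlingQ (2 * j) (2 * m) = centralFactorialCoeff (m + j) j := by
  obtain ⟨i, rfl⟩ : ∃ i, j = i + 1 := ⟨j - 1, by omega⟩
  have h := congrArg (fun q => q.coeff (2 * (i + 1))) (taylor_descPochhammer_odd (m + i))
  simp only [mul_comm 2 (i + 1), coeff_expand_mul two_pos] at h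
  rw [show (i + 1) * 2 = 2 * i + 1 + 1 by ring, coeff_X_mul,
    descPochhammer_taylor_coeff (by omega)] at h
  rw [centralFactorialCoeff, ← add_assoc, ← h, stirlingQ,
    show 2 * (m + i) + 1 + 1 - (2 * i + 1) = 2 * m + 1 by omega]
  refine Finset.sum_congr rfl fun l _ => ?_
  rw [show 2 * (i + 1) + l - 1 = 2 * i + 1 + l by omega,
    show 2 * (i + 1) - 1 = 2 * i + 1 by omega,
    show 2 * (i + 1) + 2 * m - 1 = 2 * (m + i) + 1 by omega]
  congr 2
  push_cast
  ring

end StirlingPolynomials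

/-! ### Formal expansion of even powers of arccos at `x = 1`. -/

section CentralFactorialSeries

open PowerSeries

/-- The formal expansion of `arccos x ^ (2 * j) / (2 * j)!` in powers of `x - 1`. -/
noncomputable def arccosPowSeries (j : ℕ) : ℝ⟦X⟧ :=
  PowerSeries.mk fun n => (-1) ^ j * 2 ^ n * centralFactorialCoeff n j / ((2 * n)! : ℝ)

theorem arccosPowSeries_zero : arccosPowSeries 0 = 1 := by
  ext n
  cases n with
  | zero => simp [arccosPowSeries, centralFactorialCoeff_zero]
  | succ n => simp [arccosPowSeries, centralFactorialCoeff_succ_zero, coeff_one]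

theorem constantCoeff_arccosPowSeries_succ (j : ℕ) :
    constantCoeff (arccosPowSeries (j + 1)) = 0 := by
  rw [← coeff_zero_eq_constantCoeff_apply]
  simp [arccosPowSeries, centralFactorialCoeff_zero]

/-- The operator `(1 - x²) ∂² - x ∂` in the variable `x - 1`. -/
noncomputable def chebyshevOp (f : ℝ⟦X⟧) : ℝ⟦X⟧ :=
  -(2 * X + X ^ 2) * d⁄dX ℝ (d⁄dX ℝ f) - (1 + X) * d⁄dX ℝ f

theorem coeff_chebyshevOp (f : ℝ⟦X⟧) (n : ℕ) :
    coeff n (chebyshevOp f) =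
      -((n + 1) * (2 * n + 1) * coeff (n + 1) f) - (n : ℝ) ^ 2 * coeff n f := by
  have h : chebyshevOp f = -(C 2 * (X * d⁄dX ℝ (d⁄dX ℝ f))) - X * (X * d⁄dX ℝ (d⁄dX ℝ f))
      - d⁄dX ℝ f - X * d⁄dX ℝ f := by
    rw [chebyshevOp, show (C (2 : ℝ) : ℝ⟦X⟧) = 2 from map_ofNat C 2]
    ring
  rw [h]
  rcases n with _ | _ | n
  · have h0 : constantCoeff (d⁄dX ℝ f) = coeff 1 f := by
      rw [← coeff_zero_eq_constantCoeff_apply, coeff_derivative]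
      simp
    simp [h0]
  · simp [coeff_derivative, coeff_succ_X_mul]
    ring
  · simp [coeff_derivative, coeff_succ_X_mul]
    ring

/-- In `coeff_chebyshevOp` the factor of the coefficient of index `n + 1` never vanishes, so the
operator determines every coefficient from the previous one. -/
theorem chebyshevOp_injective {f g : ℝ⟦X⟧} (h : chebyshevOp f = chebyshevOp g)
    (h0 : constantCoeff f = constantCoeff g) : f = g := by
  ext n
  induction n with
  | zero => simpa using h0
  | succ n ih =>
    have := congrArg (coeff n) h
    rw [coeff_chebyshevOp, coeff_chebyshevOp, ih] at this
    have h2 : ((n : ℝ) + 1) * (2 * n + 1) ≠ 0 := by positivity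
    apply mul_left_cancel₀ h2
    linarith

theorem chebyshevOp_C_mul (c : ℝ) (f : ℝ⟦X⟧) : chebyshevOp (C c * f) = C c * chebyshevOp f := by
  ext n
  simp only [coeff_chebyshevOp, coeff_C_mul]
  ring

theorem chebyshevOp_arccosPowSeries_succ (j : ℕ) :
    chebyshevOp (arccosPowSeries (j + 1)) = arccosPowSeries j := by
  ext n
  rw [coeff_chebyshevOp]
  simp only [arccosPowSeries, coeff_mk, centralFactorialCoeff_succ_succ]
  rw [show 2 * (n + 1) = 2 * n + 1 + 1 by ring, Nat.factorial_succ, Nat.factorial_succ]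
  have := Nat.factorial_ne_zero (2 * n)
  push_cast
  field_simp
  ring

/-- The formal expansion of `arccos x ^ 2` in powers of `x - 1`. -/
noncomputable def arccosSqSeries : ℝ⟦X⟧ := C 2 * arccosPowSeries 1

theorem chebyshevOp_arccosSqSeries : chebyshevOp arccosSqSeries = 2 := by
  rw [arccosSqSeries, chebyshevOp_C_mul, chebyshevOp_arccosPowSeries_succ, arccosPowSeries_zero,
    mul_one]
  exact map_ofNat C 2

theorem constantCoeff_arccosSqSeries : constantCoeff arccosSqSeries = 0 := by
  simp [arccosSqSeries, constantCoeff_arccosPowSeries_succ 0]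

/-- First integral of the second-order equation: with `G = arccos²`, differentiating `(1 - x²) G'² -
4 G` gives `2 G'` times that equation. -/
theorem arccosSqSeries_deriv_sq :
    -(2 * X + X ^ 2) * (d⁄dX ℝ arccosSqSeries) ^ 2 = 4 * arccosSqSeries := by
  have h := chebyshevOp_arccosSqSeries
  rw [chebyshevOp] at h
  apply derivative.ext
  · have h4 : d⁄dX ℝ (4 : ℝ⟦X⟧) = 0 := by
      rw [← map_ofNat (C (R := ℝ)) 4]; exact derivative_C
    have h2 : d⁄dX ℝ (2 : ℝ⟦X⟧) = 0 := by
      rw [← map_ofNat (C (R := ℝ)) 2]; exact derivative_C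
    simp only [Derivation.leibniz, derivative_pow, map_neg, map_add, derivative_X, h2, h4,
      smul_eq_mul]
    linear_combination (2 * d⁄dX ℝ arccosSqSeries) * h
  · simp [constantCoeff_arccosSqSeries]

theorem chebyshevOp_arccosSqSeries_pow (j : ℕ) :
    chebyshevOp (arccosSqSeries ^ (j + 1)) =
      C ((2 * j + 2) * (2 * j + 1) : ℝ) * arccosSqSeries ^ j := by
  have h := chebyshevOp_arccosSqSeries
  have hsq := arccosSqSeries_deriv_sq
  rw [chebyshevOp] at h ⊢
  have hC : (C ((2 * j + 2) * (2 * j + 1) : ℝ) : ℝ⟦X⟧) = (2 * j + 2) * (2 * j + 1) := by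
    have h2 : (C (2 : ℝ) : ℝ⟦X⟧) = 2 := map_ofNat C 2
    simp [h2]
  rw [hC]
  cases j with
  | zero => simpa using h
  | succ j =>
    have hN : ∀ n : ℕ, d⁄dX ℝ (n : ℝ⟦X⟧) = 0 := fun n => by
      rw [← map_natCast (C (R := ℝ)) n]; exact derivative_C
    simp only [Derivation.leibniz, derivative_pow, smul_eq_mul, hN, Nat.add_sub_cancel]
    push_cast
    linear_combination ((j : ℝ⟦X⟧) + 2) * arccosSqSeries ^ (j + 1) * h +
      ((j : ℝ⟦X⟧) + 2) * (j + 1) * arccosSqSeries ^ j * hsq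

/-- Both sides have the same image under `chebyshevOp`, by induction on `j`, and zero constant term
when `j > 0`. -/
theorem arccosSqSeries_pow (j : ℕ) :
    arccosSqSeries ^ j = C ((2 * j)! : ℝ) * arccosPowSeries j := by
  induction j with
  | zero => simp [arccosPowSeries_zero]
  | succ j ih =>
    apply chebyshevOp_injective
    · rw [chebyshevOp_arccosSqSeries_pow, chebyshevOp_C_mul, chebyshevOp_arccosPowSeries_succ, ih,
        ← mul_assoc, ← map_mul, show 2 * (j + 1) = 2 * j + 1 + 1 by ring, Nat.factorial_succ,
        Nat.factorial_succ]
      push_cast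
      ring_nf
    · simp [constantCoeff_arccosSqSeries, constantCoeff_arccosPowSeries_succ]

/-- The Taylor coefficients of `arccos x ^ 2 / (2 * (1 - x))` at `x = 1`. -/
noncomputable def arccosSqQuotCoeff (n : ℕ) : ℝ :=
  2 ^ (n + 1) * ((-1) ^ n * (n ! : ℝ) ^ 2) / ((2 * n + 2)! : ℝ)

theorem arccosSqSeries_eq : arccosSqSeries = C (-2) * (X * PowerSeries.mk arccosSqQuotCoeff) := by
  ext n
  cases n with
  | zero => simp [constantCoeff_arccosSqSeries]
  | succ n =>
    rw [coeff_C_mul, coeff_succ_X_mul, coeff_mk, arccosSqSeries, coeff_C_mul, arccosPowSeries,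
      coeff_mk, centralFactorialCoeff_succ_one, arccosSqQuotCoeff, mul_add 2 n 1]
    ring

theorem coeff_arccosSqQuot_pow (j m : ℕ) :
    coeff m (PowerSeries.mk arccosSqQuotCoeff ^ j) =
      2 ^ m * ((2 * j)! : ℝ) * centralFactorialCoeff (m + j) j / ((2 * j + 2 * m)! : ℝ) := by
  have h := congrArg (coeff (m + j)) (arccosSqSeries_pow j)
  rw [arccosSqSeries_eq, mul_pow, mul_pow, ← map_pow, coeff_C_mul, coeff_X_pow_mul, coeff_C_mul,
    arccosPowSeries, coeff_mk] at h
  have h2 : ((-2 : ℝ)) ^ j ≠ 0 := by positivity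
  apply mul_left_cancel₀ h2
  rw [h, mul_add 2 m j, add_comm (2 * m), neg_pow (2 : ℝ) j]
  ring

end CentralFactorialSeries

/-! ### Partial Bell polynomials as power series coefficients. -/

section BellPolynomials

open PowerSeries

theorem partialBell_smul (m k : ℕ) (c : ℝ) (x : ℕ → ℝ) :
    partialBell m k (fun n => c * x n) = c ^ k * partialBell m k x := by
  rw [partialBell, partialBell, Finset.mul_sum]
  refine Finset.sum_congr rfl fun l hl => ?_
  simp only [Finset.mem_filter, Finset.mem_piAntidiag] at hl
  have h : c ^ k = ∏ i, c ^ l i := by rw [Finset.prod_pow_eq_pow_sum, hl.1.1]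
  rw [h, mul_left_comm, ← Finset.prod_mul_distrib]
  simp only [mul_div_assoc, mul_pow]

theorem partialBell_eq_coeff {m k : ℕ} (hkm : k ≤ m) (x : ℕ → ℝ) :
    partialBell m k x = (m ! : ℝ) / (k ! : ℝ) *
      coeff m ((X * PowerSeries.mk fun n => x (n + 1) / ((n + 1)! : ℝ)) ^ k) := by
  set V : ℝ⟦X⟧ := PowerSeries.mk fun n => x (n + 1) / ((n + 1)! : ℝ) with hV
  have htr : ((trunc (m - k + 1) V : Polynomial ℝ) : ℝ⟦X⟧) =
      ∑ i : Fin (m - k + 1), C (x ((i : ℕ) + 1) / (((i : ℕ) + 1)! : ℝ)) * X ^ (i : ℕ) := by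
    rw [Fin.sum_univ_eq_sum_range
      (fun i => (C (x (i + 1) / ((i + 1)! : ℝ)) : ℝ⟦X⟧) * X ^ i) (m - k + 1)]
    ext d
    simp only [Polynomial.coeff_coe, coeff_trunc, map_sum, coeff_C_mul, coeff_X_pow, mul_ite,
      mul_one, mul_zero, Finset.sum_ite_eq, Finset.mem_range, hV, coeff_mk]
  -- The factor `X ^ k` lowers the index to `m - k`, where only the first `m - k + 1` coefficients
  -- of `V` matter; the power becomes one of a finite sum, open to the multinomial theorem.
  have hpow : coeff m ((X * V) ^ k) =
      coeff (m - k) (((trunc (m - k + 1) V : Polynomial ℝ) : ℝ⟦X⟧) ^ k) := by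
    rw [mul_pow, ← Nat.sub_add_cancel hkm, coeff_X_pow_mul, Nat.sub_add_cancel hkm,
      ← coeff_coe_trunc_of_lt (Nat.lt_succ_self (m - k)), Nat.succ_eq_add_one, ← trunc_trunc_pow,
      coeff_coe_trunc_of_lt (Nat.lt_succ_self (m - k))]
  rw [hpow, htr, Finset.sum_pow_eq_sum_piAntidiag, map_sum, Finset.mul_sum, partialBell,
    Finset.sum_filter]
  refine Finset.sum_congr rfl fun l hl => ?_
  rw [Finset.mem_piAntidiag] at hl
  -- As the exponents add up to `k`, the weight condition defining the Bell polynomial selects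
  -- exactly the monomials of degree `m - k`.
  have hsum : ∑ i : Fin (m - k + 1), ((i : ℕ) + 1) * l i =
      ∑ i : Fin (m - k + 1), (i : ℕ) * l i + k := by
    simp only [add_mul, one_mul, Finset.sum_add_distrib, hl.1]
  have hprod : ∏ i : Fin (m - k + 1),
        ((C (x ((i : ℕ) + 1) / (((i : ℕ) + 1)! : ℝ)) : ℝ⟦X⟧) * X ^ (i : ℕ)) ^ l i =
      C (∏ i : Fin (m - k + 1), (x ((i : ℕ) + 1) / (((i : ℕ) + 1)! : ℝ)) ^ l i) *
        X ^ (∑ i : Fin (m - k + 1), (i : ℕ) * l i) := by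
    simp only [mul_pow, Finset.prod_mul_distrib, ← pow_mul, Finset.prod_pow_eq_pow_sum, map_prod,
      map_pow]
  have hmult : ((Nat.multinomial Finset.univ l : ℕ) : ℝ) = (k ! : ℝ) / ∏ i, ((l i)! : ℝ) := by
    have h := Nat.multinomial_spec Finset.univ l
    rw [hl.1] at h
    rw [eq_div_iff (Finset.prod_ne_zero_iff.2 fun i _ => by positivity), mul_comm]
    exact_mod_cast h
  rw [hprod, ← map_natCast (C (R := ℝ)), ← mul_assoc, ← map_mul, coeff_C_mul, coeff_X_pow, hsum,
    hmult]
  have hiff : (∑ i : Fin (m - k + 1), (i : ℕ) * l i + k = m) ↔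
      (m - k = ∑ i : Fin (m - k + 1), (i : ℕ) * l i) := by omega
  simp only [hiff]
  have hk : (k ! : ℝ) ≠ 0 := by positivity
  split_ifs
  · field_simp
  · simp

end BellPolynomials

/-! ### Evaluation of the Bell polynomial by the binomial theorem. -/

section Evaluation

open PowerSeries

theorem bellArg_eq (n : ℕ) :
    bellArg n = ((2 * n)‼ : ℝ) / ((2 * n + 2)! : ℝ) * ((-1) ^ n * (n ! : ℝ) ^ 2) := by
  rw [bellArg, show stirlingQ 2 (2 * n) = _ from stirlingQ_even le_rfl n,
    centralFactorialCoeff_succ_one]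

theorem two_mul_bellArg (n : ℕ) : 2 * bellArg n = (n ! : ℝ) * arccosSqQuotCoeff n := by
  rw [bellArg_eq, arccosSqQuotCoeff, Nat.doubleFactorial_two_mul]
  push_cast
  ring

theorem partialBell_two_mul_bellArg {m k : ℕ} (hk : 1 ≤ k) (hkm : k ≤ m) :
    partialBell m k (fun n => 2 * bellArg n) =
      (-2 : ℝ) ^ k * ((2 * (m - k))‼ : ℝ) * (m.choose k : ℝ) *
        ∑ j ∈ Finset.Icc 1 k,
          (-1 : ℝ) ^ j * ((2 * j)! : ℝ) * (k.choose j : ℝ) *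
            (stirlingQ (2 * j) (2 * m) / ((2 * j + 2 * m)! : ℝ)) := by
  set S : ℝ⟦X⟧ := PowerSeries.mk arccosSqQuotCoeff with hS
  -- The `-1` removes the constant term `arccosSqQuotCoeff 0 = 1`.
  have hV : X * (PowerSeries.mk fun n => 2 * bellArg (n + 1) / ((n + 1)! : ℝ)) = S + (-1) := by
    ext d
    cases d with
    | zero => simp [hS, arccosSqQuotCoeff]
    | succ d =>
      have hd : ((d + 1)! : ℝ) ≠ 0 := by positivity
      rw [coeff_succ_X_mul, coeff_mk, two_mul_bellArg]
      simp [hS, coeff_one, hd]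
  rw [partialBell_eq_coeff hkm, hV, add_pow, map_sum, Finset.range_eq_Ico,
    Finset.sum_eq_sum_Ico_succ_bot (Nat.succ_pos k)]
  -- The `j = 0` term is a constant and `m ≥ 1`, which is why the final sum starts at `1`.
  have h0 : coeff m (S ^ 0 * (-1) ^ (k - 0) * (k.choose 0 : ℝ⟦X⟧)) = 0 := by
    have h1 : S ^ 0 * (-1) ^ (k - 0) * (k.choose 0 : ℝ⟦X⟧) = C ((-1 : ℝ) ^ k) := by simp
    rw [h1, coeff_C, if_neg (by omega)]
  have hc : (m ! : ℝ) / (k ! : ℝ) * 2 ^ m = 2 ^ k * ((2 * (m - k))‼ : ℝ) * (m.choose k : ℝ) := by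
    rw [Nat.doubleFactorial_two_mul, Nat.cast_choose ℝ hkm]
    have hp : (2 : ℝ) ^ m = 2 ^ k * 2 ^ (m - k) := by rw [← pow_add, Nat.add_sub_cancel' hkm]
    have := Nat.factorial_ne_zero (m - k)
    push_cast
    rw [hp]
    field_simp
  rw [h0, zero_add, neg_pow 2 k, mul_assoc (_ * _), mul_assoc (_ * _), mul_assoc ((-1 : ℝ) ^ k)]
  have hI : Finset.Ico (0 + 1) (k + 1) = Finset.Icc 1 k := by
    ext j
    simp only [Finset.mem_Ico, Finset.mem_Icc]
    omega
  simp only [Nat.succ_eq_add_one, hI, Finset.mul_sum]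
  refine Finset.sum_congr rfl fun j hj => ?_
  rw [Finset.mem_Icc] at hj
  have hterm : S ^ j * (-1) ^ (k - j) * (k.choose j : ℝ⟦X⟧) =
      C ((-1 : ℝ) ^ (k - j) * k.choose j) * S ^ j := by
    simp; ring
  have hsign : (-1 : ℝ) ^ (k - j) = (-1) ^ k * (-1) ^ j := by
    rw [← pow_add, show k + j = k - j + 2 * j by omega, pow_add _ (k - j), pow_mul]
    simp
  rw [hterm, coeff_C_mul, coeff_arccosSqQuot_pow, ← stirlingQ_even hj.1, hsign]
  linear_combination ((-1) ^ k * (-1) ^ j * (k.choose j : ℝ) * ((2 * j)! : ℝ) *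
    stirlingQ (2 * j) (2 * m) / ((2 * j + 2 * m)! : ℝ)) * hc

end Evaluation

/-! ### Derivatives of scalar power series. -/

section PowerSeriesDerivative

open FormalMultilinearSeries

theorem HasFPowerSeriesOnBall.deriv_ofScalars {F : ℝ → ℝ} {a : ℕ → ℝ} {x : ℝ} {r : ENNReal}
    (h : HasFPowerSeriesOnBall F (ofScalars ℝ a) x r) :
    HasFPowerSeriesOnBall (deriv F) (ofScalars ℝ fun n => ((n : ℝ) + 1) * a (n + 1)) x r := by
  have h1 := (ContinuousLinearMap.apply ℝ ℝ (1 : ℝ)).comp_hasFPowerSeriesOnBall h.fderiv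
  have h2 : (ContinuousLinearMap.apply ℝ ℝ (1 : ℝ)).compFormalMultilinearSeries
      (ofScalars ℝ a).derivSeries = ofScalars ℝ fun n => ((n : ℝ) + 1) * a (n + 1) := by
    funext n
    have hn := (ofScalars ℝ a).derivSeries_coeff_one n
    rw [coeff_ofScalars, nsmul_eq_mul] at hn
    push_cast at hn
    refine (mkPiRing_coeff_eq _ n).symm.trans (Eq.trans ?_ (mkPiRing_coeff_eq _ n))
    rw [coeff_ofScalars, ← hn]
    rfl
  rw [h2] at h1
  exact h1

theorem HasFPowerSeriesOnBall.hasSum_ofScalars {F : ℝ → ℝ} {a : ℕ → ℝ} {x t : ℝ} {r : ENNReal}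
    (h : HasFPowerSeriesOnBall F (ofScalars ℝ a) x r) (ht : t ∈ Metric.eball (0 : ℝ) r) :
    HasSum (fun n => a n * t ^ n) (F (x + t)) := by
  simpa only [ofScalars_apply_eq, smul_eq_mul] using h.hasSum ht

theorem HasFPowerSeriesOnBall.iteratedDeriv_ofScalars {F : ℝ → ℝ} {a : ℕ → ℝ} {x : ℝ}
    {r : ENNReal} (h : HasFPowerSeriesOnBall F (ofScalars ℝ a) x r) (n : ℕ) :
    iteratedDeriv n F x = (n ! : ℝ) * a n := by
  rw [iteratedDeriv_eq_iteratedFDeriv, ← h.factorial_smul 1 n]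
  simp

end PowerSeriesDerivative

/-! ### Analytic continuation of the quotient through `x = 1`. -/

section Arccos

open FormalMultilinearSeries Set Filter

theorem arccosSqQuotCoeff_succ (n : ℕ) :
    ((n : ℝ) + 2) * (2 * n + 3) * arccosSqQuotCoeff (n + 1) =
      -((n : ℝ) + 1) ^ 2 * arccosSqQuotCoeff n := by
  rw [arccosSqQuotCoeff, arccosSqQuotCoeff, Nat.factorial_succ n,
    show 2 * (n + 1) + 2 = 2 * n + 2 + 1 + 1 by ring, Nat.factorial_succ (2 * n + 2 + 1),
    Nat.factorial_succ (2 * n + 2)]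
  have := Nat.factorial_ne_zero (2 * n + 2)
  push_cast
  field_simp
  ring

/-- The ratio of consecutive coefficients is at most `1/2` in absolute value. This gives radius at
least `2`, so the ball around `1` covers `(-1, 1)`. -/
theorem abs_arccosSqQuotCoeff_le (n : ℕ) : |arccosSqQuotCoeff n| * 2 ^ n ≤ 1 := by
  induction n with
  | zero => simp [arccosSqQuotCoeff]
  | succ n ih =>
    have h := congrArg abs (arccosSqQuotCoeff_succ n)
    rw [abs_mul, abs_mul (-_), abs_neg, abs_of_pos (by positivity : (0 : ℝ) < (n + 2) * (2 * n + 3)),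
      abs_of_pos (by positivity : (0 : ℝ) < ((n : ℝ) + 1) ^ 2)] at h
    have hpos : (0 : ℝ) < (n + 2) * (2 * n + 3) := by positivity
    refine le_of_mul_le_mul_left ?_ hpos
    calc ((n : ℝ) + 2) * (2 * n + 3) * (|arccosSqQuotCoeff (n + 1)| * 2 ^ (n + 1))
        = 2 * ((n : ℝ) + 1) ^ 2 * (|arccosSqQuotCoeff n| * 2 ^ n) := by
          rw [pow_succ]; linear_combination (2 ^ n * 2) * h
      _ ≤ 2 * ((n : ℝ) + 1) ^ 2 * 1 := by gcongr
      _ ≤ (n + 2) * (2 * n + 3) * 1 := by nlinarith [(n.cast_nonneg : (0 : ℝ) ≤ n)]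

/-- The sum of the power series `∑ aₙ (x - 1)ⁿ` with coefficients `arccosSqQuotCoeff`. -/
noncomputable def arccosSqQuotExt (x : ℝ) : ℝ := (ofScalars ℝ arccosSqQuotCoeff).sum (x - 1)

theorem hasFPowerSeriesOnBall_arccosSqQuotExt :
    HasFPowerSeriesOnBall arccosSqQuotExt (ofScalars ℝ arccosSqQuotCoeff) 1 2 := by
  have hr : (2 : ENNReal) ≤ (ofScalars ℝ arccosSqQuotCoeff).radius := by
    refine (ofScalars ℝ arccosSqQuotCoeff).le_radius_of_bound (r := 2) 1 fun n => ?_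
    rw [ofScalars_norm]
    exact abs_arccosSqQuotCoeff_le n
  have h := ((ofScalars ℝ arccosSqQuotCoeff).hasFPowerSeriesOnBall
    (two_pos.trans_le hr)).mono two_pos hr
  simpa using! h.comp_sub 1

theorem analyticAt_arccosSqQuotExt {x : ℝ} (hx : x ∈ Ioo (-1 : ℝ) 3) :
    AnalyticAt ℝ arccosSqQuotExt x := by
  refine hasFPowerSeriesOnBall_arccosSqQuotExt.analyticAt_of_mem ?_
  rw [show (2 : ENNReal) = ENNReal.ofReal 2 by simp, Metric.eball_ofReal, Real.ball_eq_Ioo]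
  norm_num
  exact hx

/-- This is `(1 - x²) G'' - x G' = 2` written for `G = 2 (1 - x) F`. -/
theorem arccosSqQuotExt_ode {x : ℝ} (hx : x ∈ Ioo (-1 : ℝ) 3) :
    2 * (1 + x) * (x - 1) ^ 2 * deriv (deriv arccosSqQuotExt) x +
      (4 * (1 + x) * (x - 1) + 2 * x * (x - 1)) * deriv arccosSqQuotExt x +
      2 * x * arccosSqQuotExt x = 2 := by
  have hF := hasFPowerSeriesOnBall_arccosSqQuotExt
  have ht : x - 1 ∈ Metric.eball (0 : ℝ) 2 := by
    rw [show (2 : ENNReal) = ENNReal.ofReal 2 by simp, Metric.eball_ofReal, Real.ball_eq_Ioo]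
    constructor <;> linarith [hx.1, hx.2]
  have h0 := hF.hasSum_ofScalars ht
  have h1 := hF.deriv_ofScalars.hasSum_ofScalars ht
  have h2 := hF.deriv_ofScalars.deriv_ofScalars.hasSum_ofScalars ht
  rw [add_sub_cancel] at h0 h1 h2
  set t := x - 1 with ht'
  set a := arccosSqQuotCoeff
  have shift : ∀ {b : ℕ → ℝ} {s : ℝ}, HasSum (fun n => b n * t ^ n) s →
      HasSum (fun n => (if n = 0 then 0 else b (n - 1)) * t ^ n) (t * s) := by
    intro b s hb
    rw [← hasSum_nat_add_iff' 1]
    simpa [pow_succ, mul_comm, mul_left_comm, mul_assoc] using hb.mul_left t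
  have hs0 := shift h0
  have hs1 := shift h1
  have hs1' := shift hs1
  have hs2 := shift (shift h2)
  have hs2' := shift hs2
  -- Half the equation in powers of `t`: `(2t² + t³) F'' + (5t + 3t²) F' + (1 + t) F = 1`.
  have key := (((hs2.mul_left 2).add hs2').add ((hs1.mul_left 5).add (hs1'.mul_left 3))).add
    (h0.add hs0)
  have hone : ∀ {f : ℕ → ℝ} {s : ℝ}, HasSum f s → (∀ n, f n = if n = 0 then 1 else 0) → s = 1 :=
    fun hf h => (funext h ▸ hf).unique (hasSum_ite_eq 0 1)
  have hrec := arccosSqQuotCoeff_succ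
  have hsum := hone key <| by
    intro n
    -- Up to three shifts are nested, so the indices `0, 1, 2` are treated separately; index `0` is
    -- `a 0 = 1`, all others are the coefficient recurrence.
    rcases n with _ | _ | _ | n
    · simp [a, arccosSqQuotCoeff]
    · have := hrec 0
      simp [a] at this ⊢
      linear_combination t * this
    · have := hrec 1
      simp [a] at this ⊢
      linear_combination t ^ 2 * this
    · have := hrec (n + 2)
      simp [a] at this ⊢
      linear_combination t ^ (n + 3) * this
  rw [show x = 1 + t by rw [ht']; ring] at hsum ⊢
  linear_combination 2 * hsum

theorem eq_zero_of_hasDerivAt_zero {g : ℝ → ℝ} {r : ℝ} (h : ∀ y ∈ Ioo (-r) r, HasDerivAt g 0 y)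
    (h0 : g 0 = 0) {y : ℝ} (hy : y ∈ Ioo (-r) r) : g y = 0 := by
  rw [← h0]
  refine isOpen_Ioo.is_const_of_deriv_eq_zero isPreconnected_Ioo
    (fun z hz => (h z hz).differentiableAt.differentiableWithinAt) (fun z hz => (h z hz).deriv)
    hy ?_
  constructor <;> linarith [hy.1, hy.2]

theorem two_mul_one_sub_cos_mul_arccosSqQuotExt {y : ℝ} (hy : y ∈ Ioo (-Real.pi) Real.pi) :
    2 * (1 - Real.cos y) * arccosSqQuotExt (Real.cos y) = y ^ 2 := by
  have hcos : ∀ y ∈ Ioo (-Real.pi) Real.pi, Real.cos y ∈ Ioo (-1 : ℝ) 3 := fun y hy => by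
    refine ⟨?_, (Real.cos_le_one y).trans_lt (by norm_num)⟩
    rw [← Real.cos_pi, ← Real.cos_abs y]
    exact Real.cos_lt_cos_of_nonneg_of_le_pi (abs_nonneg y) le_rfl (abs_lt.2 hy)
  have hF : ∀ y ∈ Ioo (-Real.pi) Real.pi, HasDerivAt (fun z => arccosSqQuotExt (Real.cos z))
      (deriv arccosSqQuotExt (Real.cos y) * -Real.sin y) y := fun y hy =>
    (analyticAt_arccosSqQuotExt (hcos y hy)).differentiableAt.hasDerivAt.comp y
      (Real.hasDerivAt_cos y)
  have hF' : ∀ y ∈ Ioo (-Real.pi) Real.pi, HasDerivAt (fun z => deriv arccosSqQuotExt (Real.cos z))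
      (deriv (deriv arccosSqQuotExt) (Real.cos y) * -Real.sin y) y := fun y hy =>
    (analyticAt_arccosSqQuotExt (hcos y hy)).deriv.differentiableAt.hasDerivAt.comp y
      (Real.hasDerivAt_cos y)
  -- `K` is the derivative of `2 (1 - cos z) F(cos z) - z²`. The ODE says `K' = 0`, and both
  -- functions vanish at `0`, so two integrations suffice.
  set K : ℝ → ℝ := fun z => 2 * Real.sin z * arccosSqQuotExt (Real.cos z) -
    2 * (1 - Real.cos z) * Real.sin z * deriv arccosSqQuotExt (Real.cos z) - 2 * z with hK
  have hK0 : ∀ y ∈ Ioo (-Real.pi) Real.pi, K y = 0 := fun y hy => by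
    refine eq_zero_of_hasDerivAt_zero (fun z hz => ?_) (by simp [hK]) hy
    have h1 := ((Real.hasDerivAt_sin z).const_mul 2).mul (hF z hz)
    have h2 := ((((Real.hasDerivAt_cos z).const_sub 1).const_mul 2).mul
      (Real.hasDerivAt_sin z)).mul (hF' z hz)
    refine ((h1.sub h2).sub ((hasDerivAt_id z).const_mul 2)).congr_deriv ?_
    have hode := arccosSqQuotExt_ode (hcos z hz)
    have hs := Real.sin_sq_add_cos_sq z
    simp only [Pi.mul_apply]
    linear_combination hode + (-4 * deriv arccosSqQuotExt (Real.cos z) +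
      2 * (1 - Real.cos z) * deriv (deriv arccosSqQuotExt) (Real.cos z)) * hs
  have := eq_zero_of_hasDerivAt_zero (g := fun z => 2 * (1 - Real.cos z) *
    arccosSqQuotExt (Real.cos z) - z ^ 2) (fun z hz => ?_) (by simp) hy
  · linarith
  · refine (((((Real.hasDerivAt_cos z).const_sub 1).const_mul 2).mul (hF z hz)).sub
      (hasDerivAt_pow 2 z)).congr_deriv ?_
    have := hK0 z hz
    simp only [hK] at this
    push_cast
    linear_combination this

theorem arccosSqQuot_eq_arccosSqQuotExt {x : ℝ} (hx : x ∈ Ioo (-1 : ℝ) 1) :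
    arccosSqQuot x = arccosSqQuotExt x := by
  have h := two_mul_one_sub_cos_mul_arccosSqQuotExt (y := Real.arccos x)
    ⟨by linarith [Real.arccos_nonneg x, Real.pi_pos],
      by simpa using Real.arccos_lt_arccos le_rfl hx.1 hx.2.le⟩
  rw [Real.cos_arccos hx.1.le hx.2.le] at h
  rw [arccosSqQuot, ← h, mul_div_cancel_left₀]
  linarith [hx.2]

theorem contDiffOn_arccosSqQuot : ContDiffOn ℝ ∞ arccosSqQuot (Ioo (-1) 1) := by
  have h : ContDiffOn ℝ ∞ arccosSqQuotExt (Ioo (-1) 1) := fun x hx =>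
    (analyticAt_arccosSqQuotExt ⟨hx.1, hx.2.trans (by norm_num)⟩).contDiffAt.contDiffWithinAt
  exact h.congr fun x hx => arccosSqQuot_eq_arccosSqQuotExt hx

theorem tendsto_iteratedDeriv_arccosSqQuot (n : ℕ) :
    Tendsto (iteratedDeriv n arccosSqQuot) (𝓝[<] 1) (𝓝 ((n ! : ℝ) * arccosSqQuotCoeff n)) := by
  have hcont : ContinuousAt (iteratedDeriv n arccosSqQuotExt) 1 := by
    rw [iteratedDeriv_eq_iterate]
    exact ((analyticAt_arccosSqQuotExt (x := 1) (by norm_num)).iterated_deriv n).continuousAt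
  rw [← hasFPowerSeriesOnBall_arccosSqQuotExt.iteratedDeriv_ofScalars n]
  refine (hcont.tendsto.mono_left nhdsWithin_le_nhds).congr' ?_
  -- The functions agree near each `x` in `(-1, 1)`, hence so do their derivatives; the value `0`
  -- that division by zero gives `arccosSqQuot` at `1` plays no role.
  filter_upwards [Ioo_mem_nhdsLT (by norm_num : (-1 : ℝ) < 1)] with x hx
  refine Filter.EventuallyEq.iteratedDeriv_eq n ?_
  filter_upwards [isOpen_Ioo.mem_nhds hx] with y hy using (arccosSqQuot_eq_arccosSqQuotExt hy).symm

theorem arccosSqQuotDeriv_eq (n : ℕ) : arccosSqQuotDeriv n = 2 * bellArg n := by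
  rw [two_mul_bellArg]
  exact (tendsto_iteratedDeriv_arccosSqQuot n).limUnder_eq

end Arccos

theorem theorem5p1 (m k : ℕ) (hk : 1 ≤ k) (hkm : k ≤ m) :
    -- the derivatives at `1⁻` exist
    (ContDiffOn ℝ ∞ arccosSqQuot (Set.Ioo (-1) 1) ∧
      ∀ n : ℕ, 1 ≤ n →
        Filter.Tendsto (iteratedDeriv n arccosSqQuot) (𝓝[<] (1 : ℝ)) (𝓝 (arccosSqQuotDeriv n))) ∧
    -- the first terms of the explicit sequence of arguments
    (bellArg 1 = -1 / 12 ∧ bellArg 2 = 2 / 45 ∧ bellArg 3 = -3 / 70 ∧ bellArg 4 = 32 / 525 ∧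
      bellArg 5 = -80 / 693) ∧
    -- the two evaluations
    partialBell m k arccosSqQuotDeriv = (2 : ℝ) ^ k * partialBell m k bellArg ∧
    partialBell m k arccosSqQuotDeriv =
      (-2 : ℝ) ^ k * ((2 * (m - k))‼ : ℝ) * (m.choose k : ℝ) *
        ∑ j ∈ Finset.Icc 1 k,
          (-1 : ℝ) ^ j * ((2 * j)! : ℝ) * (k.choose j : ℝ) *
            (stirlingQ (2 * j) (2 * m) / ((2 * j + 2 * m)! : ℝ)) := by
  have hbell : arccosSqQuotDeriv = fun n => 2 * bellArg n := funext arccosSqQuotDeriv_eq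
  refine ⟨⟨contDiffOn_arccosSqQuot, fun n _ => ?_⟩, ?_, ?_, ?_⟩
  · rw [arccosSqQuotDeriv_eq, two_mul_bellArg]
    exact tendsto_iteratedDeriv_arccosSqQuot n
  · simp only [bellArg_eq]
    norm_num [Nat.doubleFactorial, Nat.factorial]
  · rw [hbell, partialBell_smul]
  · rw [hbell, partialBell_two_mul_bellArg hk hkm]
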